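/- Let $\mathcal{M}=(S,\mathit{Act},P,s_{\mathit{init}})$ be a finite Markov decision process: $S$ and $\mathit{Act}$ are finite, $P\colon S\times \mathit{Act}\times S\to[0,1]\cap\mathbb{Q}$ satisfies $\sum_{t\in S}P(s,\alpha,t)\in\{0,1\}$ for all $(s,\alpha)$, and for every $s\in S$ the set $\mathit{Act}(s)=\{\alpha : \sum_{t}P(s,\alpha,t)=1\}$ of enabled actions is non-empty. Let $T\subseteq S$ be a set of absorbing states (i.e. $P(t,\alpha,t)=1$ for all $t\in T$, $\alpha\in\mathit{Act}(t)$), and let $\mathit{wgt}\colon T\to\mathbb{Q}$. A scheduler $\mathfrak{S}$ assigns to each finite path $\pi$ a probability distribution on the actions enabled in the last state of $\pi$; it induces a probability measure $\Pr^{\mathfrak{S}}_{\mathcal{M}}$ on the infinite paths from $s_{\mathit{init}}$. Assume that under every scheduler $T$ is reached almost surely. Let $\mathrm{WR}(\pi)=\mathit{wgt}(t)$ if the infinite path $\pi$ reaches $t\in T$, and $\mathrm{WR}(\pi)=0$ if $\pi$ does not reach $T$. Let $\mathcal{M}\otimes\mathcal{M}$ be the synchronous product, with transition probabilities $P(s,\alpha,t)\cdot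 P(s',\beta,t')$ and initial state $(s_{\mathit{init}},s_{\mathit{init}})$. For schedulers $\mathfrak{S}_1,\mathfrak{S}_2$ of $\mathcal{M}$, let $\mathfrak{S}_1\otimes\mathfrak{S}_2$ be the product scheduler, which chooses $(\alpha,\beta)$ with probability $\mathfrak{S}_1(\pi_1)(\alpha)\cdot\mathfrak{S}_2(\pi_2)(\beta)$ after a finite path with projections $\pi_1,\pi_2$. Let $\mathrm{WR}_1,\mathrm{WR}_2$ be $\mathrm{WR}$ applied to the first and second projection of an infinite path. The demonic variance is $$\mathbb{V}^{\mathit{dem}}_{\mathcal{M}}(\mathrm{WR})=\sup_{\mathfrak{S}_1,\mathfrak{S}_2}\tfrac12\,\mathbb{E}^{\mathfrak{S}_1\otimes\mathfrak{S}_2}_{\mathcal{M}\otimes\mathcal{M}}\big((\mathrm{WR}_1-\mathrm{WR}_2)^2\big).$$ Consider the following constraints on real variables $x_{s,\alpha}$ ($s\in S$, $\alpha\in\mathit{Act}(s)$) and $y_q$ ($q\in T$): $$x_{s,\alpha}\ge 0\quad\text{for all } s\in S,\ \alpha\in\mathit{Act}(s),$$ $$\sum_{\alpha\in\mathit{Act}(s)}x_{s,\alpha}=\sum_{t\in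 S,\,\beta\in\mathit{Act}(t)}x_{t,\beta}\,P(t,\beta,s)+\mathbb{1}_{s=s_{\mathit{init}}}\quad\text{for all } s\in S\setminus T,$$ $$y_q=\sum_{t\in S\setminus T,\,\beta\in\mathit{Act}(t)}x_{t,\beta}\,P(t,\beta,q)\quad\text{for all } q\in T,$$ and the same constraints on a second, disjoint set of variables $x'_{s,\alpha},y'_q$. Then all expectations above are of integrable random variables, the supremum is finite, and $\mathbb{V}^{\mathit{dem}}_{\mathcal{M}}(\mathrm{WR})$ equals the maximum (which is attained) of the bilinear objective $$\tfrac12\sum_{q,r\in T}y_q\,y'_r\,(\mathit{wgt}(q)-\mathit{wgt}(r))^2$$ over all $(x,y)$ and $(x',y')$ satisfying these two separate systems of constraints. -/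

import Mathlib

open MeasureTheory ProbabilityTheory Finset

/-- A Markov decision process with finite state set `S`, finite action set `A`, rational transition
probabilities `P` and initial state `init`. -/
structure MDP (S A : Type*) [Fintype S] [Fintype A] where
  P : S → A → S → ℚ
  init : S
  P_nonneg : ∀ s a t, 0 ≤ P s a t
  P_le_one : ∀ s a t, P s a t ≤ 1
  sum_P : ∀ s a, ∑ t, P s a t = 0 ∨ ∑ t, P s a t = 1
  exists_enabled : ∀ s, ∃ a, ∑ t, P s a t = 1

/-- Finite alternating sequences `s₀ α₀ s₁ α₁ … sₖ` of states and actions. -/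
inductive FinPath (S A : Type*) where
  | start (s : S) : FinPath S A
  | step (π : FinPath S A) (a : A) (s : S) : FinPath S A

namespace FinPath

/-- The last state of a finite path. -/
def last {S A : Type*} : FinPath S A → S
  | start s => s
  | step _ _ s => s

/-- Apply a map to the states and a map to the actions of a finite path. -/
def map {S A S' A' : Type*} (f : S → S') (g : A → A') : FinPath S A → FinPath S' A'
  | start s => start (f s)
  | step π a s => step (map f g π) (g a) (f s)

end FinPath

/-- One step of a run: the chosen action and the successor state. -/
@[ext] structure Step (S A : Type*) where
  act : A
  state : S

instance {S A : Type*} : MeasurableSpace (Step S A) := ⊤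

instance {S A : Type*} [Finite S] [Finite A] : Finite (Step S A) :=
  Finite.of_injective (fun z : Step S A => (z.act, z.state)) (by
    intro x y h
    simp only [Prod.mk.injEq] at h
    exact Step.ext h.1 h.2)

/-- An infinite path `s₀ α₀ s₁ α₁ s₂ …` from a fixed state `s₀`, given by its steps
`(α₀, s₁), (α₁, s₂), …`. The `σ`-algebra is the product one, generated by the cylinder sets. -/
abbrev Run (S A : Type*) := ℕ → Step S A

namespace Run

/-- The prefix with `n` transitions of the infinite path from `s₀` with steps `ω`. -/
def pre {S A : Type*} (s₀ : S) (ω : Run S A) : ℕ → FinPath S A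
  | 0 => FinPath.start s₀
  | n + 1 => FinPath.step (pre s₀ ω n) (ω n).act (ω n).state

/-- The `n`-th state of the infinite path from `s₀` with steps `ω`. -/
def stateAt {S A : Type*} (s₀ : S) (ω : Run S A) (n : ℕ) : S := (pre s₀ ω n).last

/-- Apply a map to the states and a map to the actions of a run. -/
def map {S A S' A' : Type*} (f : S → S') (g : A → A') (ω : Run S A) : Run S' A' :=
  fun n => ⟨g (ω n).act, f (ω n).state⟩

end Run

namespace MDP

/-- The set of actions enabled in `s`. -/
def enabled {S A : Type*} [Fintype S] [Fintype A] (M : MDP S A) (s : S) : Finset A :=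
  {a | ∑ t, M.P s a t = 1}

/-- `s` is absorbing: all actions enabled in `s` return to `s` with probability one. -/
def IsAbsorbing {S A : Type*} [Fintype S] [Fintype A] (M : MDP S A) (s : S) : Prop :=
  ∀ a ∈ M.enabled s, M.P s a s = 1

/-- The synchronous product of two Markov decision processes. -/
def prod {S A S' A' : Type*} [Fintype S] [Fintype A] [Fintype S'] [Fintype A']
    (M : MDP S A) (N : MDP S' A') : MDP (S × S') (A × A') where
  P s a t := M.P s.1 a.1 t.1 * N.P s.2 a.2 t.2
  init := (M.init, N.init)
  P_nonneg s a t := mul_nonneg (M.P_nonneg _ _ _) (N.P_nonneg _ _ _)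
  P_le_one s a t := mul_le_one₀ (M.P_le_one _ _ _) (N.P_nonneg _ _ _) (N.P_le_one _ _ _)
  sum_P s a := by
    rw [Fintype.sum_prod_type, ← Fintype.sum_mul_sum]
    rcases M.sum_P s.1 a.1 with h | h <;> rcases N.sum_P s.2 a.2 with h' | h' <;> simp [h, h']
  exists_enabled s := by
    obtain ⟨a, ha⟩ := M.exists_enabled s.1
    obtain ⟨b, hb⟩ := N.exists_enabled s.2
    refine ⟨(a, b), ?_⟩
    rw [Fintype.sum_prod_type, ← Fintype.sum_mul_sum]
    simp [ha, hb]

/-- A (history-dependent, randomized) scheduler: it assigns to every finite path a probability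
distribution on the actions enabled in its last state. For convenience the function is also
defined on alternating sequences that contain a transition of probability zero; its values there
have no influence on the induced probability measure. -/
structure Scheduler {S A : Type*} [Fintype S] [Fintype A] (M : MDP S A) where
  prob : FinPath S A → A → ℝ
  prob_nonneg : ∀ π a, 0 ≤ prob π a
  sum_prob : ∀ π, ∑ a, prob π a = 1
  prob_eq_zero : ∀ π a, a ∉ M.enabled π.last → prob π a = 0

theorem last_map {S A S' A' : Type*} (f : S → S') (g : A → A') (π : FinPath S A) :
    (π.map f g).last = f π.last := by
  cases π <;> rfl

/-- The product scheduler, which resolves the choices in the two components independently. -/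
def Scheduler.prod {S A S' A' : Type*} [Fintype S] [Fintype A] [Fintype S'] [Fintype A']
    {M : MDP S A} {N : MDP S' A'} (σ : M.Scheduler) (τ : N.Scheduler) :
    (M.prod N).Scheduler where
  prob π a := σ.prob (π.map Prod.fst Prod.fst) a.1 * τ.prob (π.map Prod.snd Prod.snd) a.2
  prob_nonneg π a := mul_nonneg (σ.prob_nonneg _ _) (τ.prob_nonneg _ _)
  sum_prob π := by
    rw [Fintype.sum_prod_type, ← Fintype.sum_mul_sum, σ.sum_prob, τ.sum_prob, one_mul]
  prob_eq_zero π a h := by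
    by_contra hne
    have h1 : a.1 ∈ M.enabled π.last.1 := by
      by_contra h1
      exact hne (by rw [σ.prob_eq_zero _ _ (by rwa [last_map]), zero_mul])
    have h2 : a.2 ∈ N.enabled π.last.2 := by
      by_contra h2
      exact hne (by rw [τ.prob_eq_zero _ _ (by rwa [last_map]), mul_zero])
    apply h
    simp only [enabled, mem_filter, mem_univ, true_and] at h1 h2 ⊢
    change ∑ t : S × S', M.P π.last.1 a.1 t.1 * N.P π.last.2 a.2 t.2 = 1
    rw [Fintype.sum_prod_type, ← Fintype.sum_mul_sum, h1, h2, one_mul]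

noncomputable section

/-- The distribution of the next step after the finite path `π`: action `a` and successor `t` are
chosen with probability `σ(π)(a) · P(last π, a, t)`. -/
def Scheduler.stepMeasure {S A : Type*} [Fintype S] [Fintype A] {M : MDP S A} (σ : M.Scheduler)
    (π : FinPath S A) : Measure (Step S A) :=
  ∑ a, ∑ t, ENNReal.ofReal (σ.prob π a * (M.P π.last a t : ℝ)) • Measure.dirac ⟨a, t⟩

instance {S A : Type*} [Fintype S] [Fintype A] {M : MDP S A} (σ : M.Scheduler)
    (π : FinPath S A) : IsProbabilityMeasure (σ.stepMeasure π) := by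
  constructor
  have hnn : ∀ a t, 0 ≤ σ.prob π a * (M.P π.last a t : ℝ) := fun a t =>
    mul_nonneg (σ.prob_nonneg _ _) (by exact_mod_cast M.P_nonneg _ _ _)
  simp only [Scheduler.stepMeasure, Measure.coe_finsetSum, Finset.sum_apply, Measure.smul_apply,
    measure_univ, smul_eq_mul, mul_one]
  have hin : ∀ a, ∑ t, ENNReal.ofReal (σ.prob π a * (M.P π.last a t : ℝ))
      = ENNReal.ofReal (σ.prob π a) := by
    intro a
    rw [← ENNReal.ofReal_sum_of_nonneg (fun t _ => hnn a t), ← Finset.mul_sum]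
    by_cases h : a ∈ M.enabled π.last
    · have h' : ∑ t, M.P π.last a t = 1 := by simpa [enabled] using h
      have h'' : ∑ t, (M.P π.last a t : ℝ) = 1 := by exact_mod_cast h'
      rw [h'', mul_one]
    · rw [σ.prob_eq_zero π a h, zero_mul]
  rw [Finset.sum_congr rfl (fun a _ => hin a),
    ← ENNReal.ofReal_sum_of_nonneg (fun a _ => σ.prob_nonneg π a), σ.sum_prob,
    ENNReal.ofReal_one]

/-- The next-step kernel: given the steps `0, …, n`, the step `n + 1` is distributed according to
`stepMeasure` of the finite path from the initial state that consists of these steps. -/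
def Scheduler.stepKernel {S A : Type*} [Fintype S] [Fintype A] {M : MDP S A} (σ : M.Scheduler)
    (n : ℕ) : Kernel (Π _ : Iic n, Step S A) (Step S A) :=
  Kernel.ofFunOfCountable fun x =>
    σ.stepMeasure (Run.pre M.init (fun i => x ⟨min i n, by simp⟩) (n + 1))

instance {S A : Type*} [Fintype S] [Fintype A] {M : MDP S A} (σ : M.Scheduler) (n : ℕ) :
    IsMarkovKernel (σ.stepKernel n) :=
  ⟨fun x => inferInstanceAs (IsProbabilityMeasure (σ.stepMeasure
    (Run.pre M.init (fun i => x ⟨min i n, by simp⟩) (n + 1))))⟩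

/-- The probability measure on infinite paths from the initial state induced by a scheduler
(Ionescu-Tulcea extension of the cylinder probabilities). -/
def Scheduler.measure {S A : Type*} [Fintype S] [Fintype A] {M : MDP S A} (σ : M.Scheduler) :
    Measure (Run S A) :=
  Kernel.trajMeasure (X := fun _ => Step S A) (σ.stepMeasure (FinPath.start M.init)) σ.stepKernel

/-- `V^{σ,τ}(X) = ½ E^{σ ⊗ τ}((X₁ - X₂)²)`, where `X₁` and `X₂` are `X` applied to the two
components of a path of the product of `M` with itself. -/
def pairVariance {S A : Type*} [Fintype S] [Fintype A] (M : MDP S A) (X : Run S A → ℝ)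
    (σ τ : M.Scheduler) : ℝ :=
  1 / 2 * ∫ ω, (X (ω.map Prod.fst Prod.fst) - X (ω.map Prod.snd Prod.snd)) ^ 2
    ∂(σ.prod τ).measure

/-- The demonic variance: the supremum of `V^{σ,τ}(X)` over all pairs of schedulers. -/
def demonicVariance {S A : Type*} [Fintype S] [Fintype A] (M : MDP S A) (X : Run S A → ℝ) : ℝ :=
  ⨆ p : M.Scheduler × M.Scheduler, M.pairVariance X p.1 p.2

open Classical in
/-- Weighted reachability: the weight of the first state in `T` on the path from the initial state,
and `0` if `T` is not reached. (For absorbing `T`, almost every path visits at most one state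
of `T`.) -/
def WR {S A : Type*} [Fintype S] [Fintype A] (M : MDP S A) (T : Finset S) (wgt : T → ℚ)
    (ω : Run S A) : ℝ :=
  if h : ∃ n, Run.stateAt M.init ω n ∈ T then (wgt ⟨_, Nat.find_spec h⟩ : ℝ) else 0

/-- The linear constraint system for occupation measures with variables `x_{s,α}` (for the
state-action pairs, `α` enabled in `s`) and `y_q` (for `q ∈ T`). -/
structure OccupationConstraints {S A : Type*} [Fintype S] [Fintype A] [DecidableEq S]
    (M : MDP S A) (T : Finset S) (x : S → A → ℝ) (y : T → ℝ) : Prop where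
  nonneg : ∀ s, ∀ a ∈ M.enabled s, 0 ≤ x s a
  flow : ∀ s ∉ T, ∑ a ∈ M.enabled s, x s a =
    ∑ t, ∑ b ∈ M.enabled t, x t b * (M.P t b s : ℝ) + if s = M.init then 1 else 0
  reach : ∀ q : T, y q = ∑ t ∈ Tᶜ, ∑ b ∈ M.enabled t, x t b * (M.P t b q : ℝ)

/-- The bilinear objective `½ ∑_{q,r ∈ T} y_q y'_r (wgt(q) - wgt(r))²`. -/
def bilinearObjective {S : Type*} {T : Finset S} (wgt : T → ℚ) (y y' : T → ℝ) : ℝ :=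
  1 / 2 * ∑ q, ∑ r, y q * y' r * ((wgt q : ℝ) - (wgt r : ℝ)) ^ 2

end

end MDP

/-! A pair of schedulers enters its variance only through the two limiting distributions on `T`. The
expectation of a function of the `n`-step prefix is computed by the recursion `expect`
(`integral_pre`), and for a product scheduler it factorizes (`expect_prod`). Almost every run stays
in `T` once it is there, so dominated convergence gives `pairVariance_WR_eq`: if the state
probabilities converge to `y` and `y'` on `T` and to zero elsewhere, the variance is the bilinear
objective at `y`, `y'`.

It remains to compare these limits with the solutions of the linear system. From a scheduler,
expected visit counts up to time `N` increase with `N`, and their limit solves the system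
(`exists_occupationConstraints`). Conversely, normalizing a solution `x` gives a memoryless
scheduler (`OccupationConstraints.exists_scheduler`). Its visit counts need not equal `x`, since `x`
may carry extra circulation, but they are bounded by `x` outside `T`. Hence its probabilities on `T`
are at most `y`, and as both have total mass one in the limit, they agree there.

Attainment needs compactness, although the feasible set itself may be unbounded.
`exists_occupation_le` bounds the visit counts outside `T` uniformly over all schedulers, by a drift
argument with finite-horizon avoidance probabilities. So every scheduler is represented in a compact
set of solutions, on which the continuous objective has a maximum. If the initial state lies in `T`,
both sides are zero. -/

open Filter Topology

/-! ### Prefixes of runs and their measurability. -/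

namespace Run

theorem pre_congr {S A : Type*} (s : S) {ω ω' : Run S A} {n : ℕ} (h : ∀ i < n, ω i = ω' i) :
    pre s ω n = pre s ω' n := by
  induction n with
  | zero => rfl
  | succ n ih => rw [pre, pre, ih fun i hi => h i (by omega), h n (by omega)]

/-- The truncation `min i n` turns a tuple of the first `n + 1` steps into a run; the padding is
never read. This is the form in which `stepKernel` receives its history. -/
theorem pre_eq_pre_frestrictLe {S A : Type*} (s : S) (ω : Run S A) (n : ℕ) :
    pre s ω (n + 1) =
      pre s (fun i => Preorder.frestrictLe (π := fun _ => Step S A) n ω ⟨min i n, by simp⟩)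
        (n + 1) := by
  refine pre_congr s fun i hi => ?_
  simp [min_eq_left (Nat.lt_succ_iff.1 hi)]

theorem pre_map {S A S' A' : Type*} (f : S → S') (g : A → A') (s : S) (ω : Run S A) (n : ℕ) :
    pre (f s) (ω.map f g) n = (pre s ω n).map f g := by
  induction n with
  | zero => rfl
  | succ n ih => rw [pre, pre, FinPath.map, ih]; rfl

theorem measurable_comp_pre {S A : Type*} [Finite S] [Finite A] (s : S) (n : ℕ)
    (f : FinPath S A → ℝ) : Measurable fun ω : Run S A => f (pre s ω n) := by
  cases n with
  | zero => exact measurable_const (a := f (FinPath.start s))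
  | succ n =>
    have h : (fun ω : Run S A => f (pre s ω (n + 1))) =
        (fun x : Π _ : Iic n, Step S A => f (pre s (fun i => x ⟨min i n, by simp⟩) (n + 1))) ∘
          Preorder.frestrictLe (π := fun _ => Step S A) n := by
      funext ω
      rw [pre_eq_pre_frestrictLe]
      rfl
    rw [h]
    exact (measurable_of_countable _).comp (Preorder.measurable_frestrictLe _)

end Run

/-! ### Expectations of functions of a finite prefix. -/

namespace MDP

variable {S A : Type*} [Fintype S] [Fintype A] {M : MDP S A}

namespace Scheduler

/-- The conditional expectation of `f`, evaluated one step later, given the finite path `π`. -/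
noncomputable def next (σ : M.Scheduler) (f : FinPath S A → ℝ) (π : FinPath S A) : ℝ :=
  ∑ a, ∑ t, σ.prob π a * (M.P π.last a t : ℝ) * f (π.step a t)

/-- The expectation of `f` evaluated at the prefix with `n` transitions. -/
noncomputable def expect (σ : M.Scheduler) : ℕ → (FinPath S A → ℝ) → ℝ
  | 0, f => f (FinPath.start M.init)
  | n + 1, f => expect σ n (σ.next f)

instance (σ : M.Scheduler) : IsProbabilityMeasure σ.measure := by
  unfold measure
  infer_instance

theorem weight_nonneg (σ : M.Scheduler) (π : FinPath S A) (a : A) (t : S) :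
    0 ≤ σ.prob π a * (M.P π.last a t : ℝ) :=
  mul_nonneg (σ.prob_nonneg _ _) (by exact_mod_cast M.P_nonneg _ _ _)

theorem integral_stepMeasure (σ : M.Scheduler) (π : FinPath S A) (g : Step S A → ℝ) :
    ∫ z, g z ∂σ.stepMeasure π = ∑ a, ∑ t, σ.prob π a * (M.P π.last a t : ℝ) * g ⟨a, t⟩ := by
  have hi : ∀ a t, Integrable g
      (ENNReal.ofReal (σ.prob π a * (M.P π.last a t : ℝ)) • Measure.dirac ⟨a, t⟩) := fun a t =>
    Integrable.smul_measure (integrable_dirac (by simp)) (by simp)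
  rw [stepMeasure, integral_finsetSum_measure
    fun a _ => integrable_finsetSum_measure.2 fun t _ => hi a t]
  refine Finset.sum_congr rfl fun a _ => ?_
  rw [integral_finsetSum_measure fun t _ => hi a t]
  refine Finset.sum_congr rfl fun t _ => ?_
  rw [integral_smul_measure, integral_dirac, ENNReal.toReal_ofReal (σ.weight_nonneg π a t),
    smul_eq_mul]

theorem map_eval_zero_measure (σ : M.Scheduler) :
    σ.measure.map (fun ω => ω 0) = σ.stepMeasure (FinPath.start M.init) := by
  have h0 : σ.measure.map (Preorder.frestrictLe (π := fun _ => Step S A) 0) =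
      (σ.stepMeasure (FinPath.start M.init)).map
        (MeasurableEquiv.piUnique fun _ : Iic 0 => Step S A).symm := by
    rw [measure, Kernel.trajMeasure, Measure.map_comp _ _ (by fun_prop),
      Kernel.traj_map_frestrictLe, Kernel.partialTraj_self, Measure.id_comp]
  have h1 : (fun ω : Run S A => ω 0) =
      (fun x : Π _ : Iic 0, Step S A => x ⟨0, by simp⟩) ∘
        Preorder.frestrictLe (π := fun _ => Step S A) 0 := rfl
  have h2 : Measurable fun x : Π _ : Iic 0, Step S A => x ⟨0, by simp⟩ := measurable_pi_apply _
  rw [h1, ← Measure.map_map h2 (Preorder.measurable_frestrictLe _), h0,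
    Measure.map_map h2 (MeasurableEquiv.measurable _)]
  exact Measure.map_id

/-- The tower property. Step `0` is governed by the initial distribution, every later step by
`stepKernel`, through the disintegration of the trajectory measure; hence the two cases. -/
theorem integral_pre_succ (σ : M.Scheduler) (n : ℕ) (f : FinPath S A → ℝ) :
    ∫ ω, f (Run.pre M.init ω (n + 1)) ∂σ.measure =
      ∫ ω, σ.next f (Run.pre M.init ω n) ∂σ.measure := by
  cases n with
  | zero =>
    have h : ∫ z, f ((FinPath.start M.init).step z.act z.state) ∂σ.measure.map (fun ω => ω 0) =
        ∫ ω, f (Run.pre M.init ω 1) ∂σ.measure :=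
      integral_map (measurable_pi_apply 0).aemeasurable
        (measurable_of_countable _).aestronglyMeasurable
    rw [zero_add, ← h, map_eval_zero_measure, integral_stepMeasure]
    simp [Run.pre, next]
  | succ n =>
    let F : (Π _ : Iic n, Step S A) × Step S A → ℝ := fun z =>
      f ((Run.pre M.init (fun i => z.1 ⟨min i n, by simp⟩) (n + 1)).step z.2.act z.2.state)
    have hF : Measurable F := measurable_of_countable _
    have hmap : Measurable fun ω : Run S A =>
        (Preorder.frestrictLe (π := fun _ => Step S A) n ω, ω (n + 1)) :=
      (Preorder.measurable_frestrictLe _).prodMk (measurable_pi_apply _)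
    have h1 : ∀ ω : Run S A, f (Run.pre M.init ω (n + 1 + 1)) =
        F (Preorder.frestrictLe (π := fun _ => Step S A) n ω, ω (n + 1)) := fun ω => by
      rw [Run.pre, Run.pre_eq_pre_frestrictLe]
    have h2 : ∀ ω : Run S A, σ.next f (Run.pre M.init ω (n + 1)) =
        ∫ z, F (Preorder.frestrictLe (π := fun _ => Step S A) n ω, z)
          ∂σ.stepKernel n (Preorder.frestrictLe (π := fun _ => Step S A) n ω) := fun ω => by
      rw [Run.pre_eq_pre_frestrictLe, next]
      exact (integral_stepMeasure σ
        (Run.pre M.init (fun i => Preorder.frestrictLe (π := fun _ => Step S A) n ω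
          ⟨min i n, by simp⟩) (n + 1))
        fun z => F (Preorder.frestrictLe (π := fun _ => Step S A) n ω, z)).symm
    have hm : σ.measure.map (fun ω => (Preorder.frestrictLe (π := fun _ => Step S A) n ω, ω (n + 1)))
        = σ.measure.map (Preorder.frestrictLe (π := fun _ => Step S A) n) ⊗ₘ σ.stepKernel n :=
      Kernel.map_frestrictLe_trajMeasure_compProd_eq_map_trajMeasure.symm
    have : IsProbabilityMeasure
        (σ.measure.map (Preorder.frestrictLe (π := fun _ => Step S A) n)) :=
      Measure.isProbabilityMeasure_map (Preorder.measurable_frestrictLe _).aemeasurable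
    simp_rw [h1, h2]
    rw [← integral_map hmap.aemeasurable hF.aestronglyMeasurable, hm,
      Measure.integral_compProd Integrable.of_finite, integral_map
      (Preorder.measurable_frestrictLe _).aemeasurable
      (measurable_of_countable _).aestronglyMeasurable]

theorem integral_pre (σ : M.Scheduler) (n : ℕ) (f : FinPath S A → ℝ) :
    ∫ ω, f (Run.pre M.init ω n) ∂σ.measure = σ.expect n f := by
  induction n generalizing f with
  | zero => simp [Run.pre, expect]
  | succ n ih => rw [integral_pre_succ, ih, expect]

end Scheduler

end MDP

theorem Run.integrable_comp_pre {S A : Type*} [Finite S] [Finite A] (s : S) (n : ℕ)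
    (f : FinPath S A → ℝ) (μ : Measure (Run S A)) [IsFiniteMeasure μ] :
    Integrable (fun ω : Run S A => f (pre s ω n)) μ := by
  cases n with
  | zero => exact integrable_const (f (FinPath.start s))
  | succ n =>
    have h := (Integrable.of_finite
      (μ := μ.map (Preorder.frestrictLe (π := fun _ => Step S A) n))
      (f := fun x => f (pre s (fun i => x ⟨min i n, by simp⟩) (n + 1)))).comp_measurable
      (Preorder.measurable_frestrictLe _)
    exact h.congr (ae_of_all _ fun ω => congrArg f (pre_eq_pre_frestrictLe s ω n).symm)

/-! ### Calculus of `next` and `expect`. -/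

namespace MDP

variable {S A : Type*} [Fintype S] [Fintype A] {M : MDP S A}

theorem mem_enabled {s : S} {a : A} : a ∈ M.enabled s ↔ ∑ t, M.P s a t = 1 := by
  simp [enabled]

theorem sum_P_of_mem_enabled {s : S} {a : A} (h : a ∈ M.enabled s) : ∑ t, (M.P s a t : ℝ) = 1 := by
  exact_mod_cast mem_enabled.1 h

theorem P_cast_nonneg (M : MDP S A) (s : S) (a : A) (t : S) : (0 : ℝ) ≤ M.P s a t := by
  exact_mod_cast M.P_nonneg s a t

theorem IsAbsorbing.eq_of_pos {s t : S} (h : M.IsAbsorbing s) {a : A} (ha : a ∈ M.enabled s)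
    (ht : 0 < M.P s a t) : t = s := by
  classical
  by_contra hne
  have h1 : M.P s a s + M.P s a t ≤ ∑ u, M.P s a u := by
    rw [← Finset.sum_pair (f := M.P s a) (Ne.symm hne)]
    exact Finset.sum_le_univ_sum_of_nonneg fun u => M.P_nonneg s a u
  rw [mem_enabled.1 ha, h a ha] at h1
  linarith

/-- A set of states that contains the initial state and is closed under transitions. -/
structure IsInvariant (M : MDP S A) (R : Set S) : Prop where
  init_mem : M.init ∈ R
  step_mem : ∀ s ∈ R, ∀ a ∈ M.enabled s, ∀ t, 0 < M.P s a t → t ∈ R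

theorem isInvariant_univ (M : MDP S A) : M.IsInvariant Set.univ :=
  ⟨Set.mem_univ _, fun _ _ _ _ _ _ => Set.mem_univ _⟩

namespace Scheduler

variable (σ : M.Scheduler)

theorem mem_enabled_of_prob_ne_zero {π : FinPath S A} {a : A} (h : σ.prob π a ≠ 0) :
    a ∈ M.enabled π.last := by
  by_contra h'
  exact h (σ.prob_eq_zero _ _ h')

theorem next_mono_of_support {f g : FinPath S A → ℝ} {π : FinPath S A}
    (h : ∀ a ∈ M.enabled π.last, ∀ t, 0 < M.P π.last a t → f (π.step a t) ≤ g (π.step a t)) :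
    σ.next f π ≤ σ.next g π := by
  refine Finset.sum_le_sum fun a _ => Finset.sum_le_sum fun t _ => ?_
  by_cases ha : σ.prob π a = 0
  · simp [ha]
  rcases (M.P_nonneg π.last a t).eq_or_lt with h0 | h0
  · simp [← h0]
  · exact mul_le_mul_of_nonneg_left (h a (σ.mem_enabled_of_prob_ne_zero ha) t h0)
      (σ.weight_nonneg π a t)

theorem next_congr_of_support {f g : FinPath S A → ℝ} {π : FinPath S A}
    (h : ∀ a ∈ M.enabled π.last, ∀ t, 0 < M.P π.last a t → f (π.step a t) = g (π.step a t)) :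
    σ.next f π = σ.next g π :=
  le_antisymm (σ.next_mono_of_support fun a ha t ht => (h a ha t ht).le)
    (σ.next_mono_of_support fun a ha t ht => (h a ha t ht).ge)

theorem next_last (g : S → ℝ) (π : FinPath S A) :
    σ.next (fun π => g π.last) π =
      ∑ a ∈ M.enabled π.last, σ.prob π a * ∑ t, (M.P π.last a t : ℝ) * g t := by
  rw [Finset.sum_subset (Finset.subset_univ _) fun a _ ha => by rw [σ.prob_eq_zero _ _ ha, zero_mul]]
  simp only [next, FinPath.last, Finset.mul_sum, mul_assoc]

theorem sum_enabled_prob (π : FinPath S A) : ∑ a ∈ M.enabled π.last, σ.prob π a = 1 := by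
  rw [Finset.sum_subset (Finset.subset_univ _) fun a _ ha => σ.prob_eq_zero _ _ ha, σ.sum_prob]

theorem next_const (c : ℝ) (π : FinPath S A) : σ.next (fun _ => c) π = c := by
  rw [σ.next_last (fun _ => c)]
  simp_rw [← Finset.sum_mul]
  rw [Finset.sum_congr rfl fun a ha => by rw [sum_P_of_mem_enabled ha, one_mul],
    ← Finset.sum_mul, σ.sum_enabled_prob, one_mul]

theorem next_add (f g : FinPath S A → ℝ) (π : FinPath S A) :
    σ.next (fun π => f π + g π) π = σ.next f π + σ.next g π := by
  simp only [next, mul_add, Finset.sum_add_distrib]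

theorem next_const_mul (c : ℝ) (f : FinPath S A → ℝ) (π : FinPath S A) :
    σ.next (fun π => c * f π) π = c * σ.next f π := by
  simp only [next, Finset.mul_sum, mul_left_comm]

theorem expect_add (n : ℕ) (f g : FinPath S A → ℝ) :
    σ.expect n (fun π => f π + g π) = σ.expect n f + σ.expect n g := by
  induction n generalizing f g with
  | zero => rfl
  | succ n ih => rw [expect, expect, expect, ← ih]; congr 1; funext π; exact σ.next_add f g π

theorem expect_const_mul (n : ℕ) (c : ℝ) (f : FinPath S A → ℝ) :
    σ.expect n (fun π => c * f π) = c * σ.expect n f := by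
  induction n generalizing f with
  | zero => rfl
  | succ n ih => rw [expect, expect, ← ih]; congr 1; funext π; exact σ.next_const_mul c f π

theorem expect_const (n : ℕ) (c : ℝ) : σ.expect n (fun _ => c) = c := by
  induction n with
  | zero => rfl
  | succ n ih => rw [expect, ← ih]; congr 1; funext π; rw [σ.next_const, ih]

theorem expect_mul_const (n : ℕ) (c : ℝ) (f : FinPath S A → ℝ) :
    σ.expect n (fun π => f π * c) = σ.expect n f * c := by
  simp_rw [mul_comm _ c]
  exact σ.expect_const_mul n c f

theorem expect_sum {ι : Type*} (n : ℕ) (s : Finset ι) (f : ι → FinPath S A → ℝ) :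
    σ.expect n (fun π => ∑ i ∈ s, f i π) = ∑ i ∈ s, σ.expect n (f i) := by
  classical
  induction s using Finset.induction_on with
  | empty => simpa using σ.expect_const n 0
  | insert i s hi ih => simp_rw [Finset.sum_insert hi, expect_add, ih]

/-- Only paths ending in `R` carry weight. This localizes the later drift inequality, which can fail
at states outside an invariant set. -/
theorem expect_mono_of_isInvariant {R : Set S} (hR : M.IsInvariant R) (n : ℕ)
    {f g : FinPath S A → ℝ} (h : ∀ π, π.last ∈ R → f π ≤ g π) : σ.expect n f ≤ σ.expect n g := by
  induction n generalizing f g with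
  | zero => exact h _ hR.init_mem
  | succ n ih =>
    exact ih fun π hπ => σ.next_mono_of_support fun a ha t ht => h _ (hR.step_mem _ hπ a ha t ht)

theorem expect_mono (n : ℕ) {f g : FinPath S A → ℝ} (h : ∀ π, f π ≤ g π) :
    σ.expect n f ≤ σ.expect n g :=
  σ.expect_mono_of_isInvariant M.isInvariant_univ n fun π _ => h π

theorem expect_nonneg (n : ℕ) {f : FinPath S A → ℝ} (h : ∀ π, 0 ≤ f π) : 0 ≤ σ.expect n f :=
  (σ.expect_const n 0).ge.trans (σ.expect_mono n h)

/-- Both the action choice and the transition probability are products, so `next` maps products of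
functions of the two projections to such products. -/
theorem expect_prod {S' A' : Type*} [Fintype S'] [Fintype A'] {N : MDP S' A'} (τ : N.Scheduler)
    (n : ℕ) (f : FinPath S A → ℝ) (g : FinPath S' A' → ℝ) :
    (σ.prod τ).expect n (fun π => f (π.map Prod.fst Prod.fst) * g (π.map Prod.snd Prod.snd)) =
      σ.expect n f * τ.expect n g := by
  induction n generalizing f g with
  | zero => rfl
  | succ n ih =>
    rw [expect, expect, expect, ← ih]
    congr 1
    funext π
    simp only [next]
    rw [Fintype.sum_prod_type, Fintype.sum_mul_sum]
    refine Finset.sum_congr rfl fun a _ => Finset.sum_congr rfl fun b _ => ?_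
    rw [Fintype.sum_prod_type, Fintype.sum_mul_sum]
    refine Finset.sum_congr rfl fun t _ => Finset.sum_congr rfl fun u _ => ?_
    simp only [prod, MDP.prod, FinPath.map, last_map, Rat.cast_mul]
    ring

end Scheduler

/-! ### Runs with possible steps, and absorption in `T`. -/

/-- Every step of the run `ω` has positive probability. -/
def IsPossible (M : MDP S A) (ω : Run S A) : Prop :=
  ∀ n, (ω n).act ∈ M.enabled (Run.stateAt M.init ω n) ∧
    0 < M.P (Run.stateAt M.init ω n) (ω n).act (Run.stateAt M.init ω (n + 1))

theorem Scheduler.ae_isPossible (σ : M.Scheduler) : ∀ᵐ ω ∂σ.measure, M.IsPossible ω := by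
  classical
  refine ae_all_iff.2 fun n => ?_
  -- Indicator that the last step is impossible; its expectation vanishes because `next` sees only
  -- enabled actions and successors of positive probability.
  let f : FinPath S A → ℝ := fun π => match π with
    | .start _ => 0
    | .step π a t => if a ∈ M.enabled π.last ∧ 0 < M.P π.last a t then 0 else 1
  have hf : ∀ π, 0 ≤ f π := by
    rintro (s | ⟨π, a, t⟩)
    · exact le_rfl
    · simp only [f]; split_ifs <;> norm_num
  have h0 : ∫ ω, f (Run.pre M.init ω (n + 1)) ∂σ.measure = 0 := by
    rw [σ.integral_pre, Scheduler.expect, ← σ.expect_const n 0]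
    congr 1
    funext π
    refine Eq.trans ?_ (σ.next_const 0 π)
    exact σ.next_congr_of_support fun a ha t ht => if_pos ⟨ha, ht⟩
  rw [integral_eq_zero_iff_of_nonneg (fun ω => hf _) (Run.integrable_comp_pre _ _ _ _)] at h0
  filter_upwards [h0] with ω hω
  by_contra h
  have : f (Run.pre M.init ω (n + 1)) = 1 := if_neg h
  rw [hω] at this
  simp at this

theorem IsPossible.components {S' A' : Type*} [Fintype S'] [Fintype A'] {N : MDP S' A'}
    {ω : Run (S × S') (A × A')} (h : (M.prod N).IsPossible ω) :
    M.IsPossible (ω.map Prod.fst Prod.fst) ∧ N.IsPossible (ω.map Prod.snd Prod.snd) := by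
  have key : ∀ (s : S × S') (a : A × A') (t : S × S'), a ∈ (M.prod N).enabled s →
      0 < (M.prod N).P s a t → (a.1 ∈ M.enabled s.1 ∧ 0 < M.P s.1 a.1 t.1) ∧
        a.2 ∈ N.enabled s.2 ∧ 0 < N.P s.2 a.2 t.2 := by
    intro s a t ha ht
    rw [mem_enabled] at ha
    change ∑ t : S × S', M.P s.1 a.1 t.1 * N.P s.2 a.2 t.2 = 1 at ha
    rw [Fintype.sum_prod_type, ← Fintype.sum_mul_sum] at ha
    change 0 < M.P s.1 a.1 t.1 * N.P s.2 a.2 t.2 at ht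
    refine ⟨⟨mem_enabled.2 ((M.sum_P s.1 a.1).resolve_left fun h0 => ?_),
      pos_of_mul_pos_left ht (N.P_nonneg _ _ _)⟩,
      mem_enabled.2 ((N.sum_P s.2 a.2).resolve_left fun h0 => ?_),
      pos_of_mul_pos_right ht (M.P_nonneg _ _ _)⟩ <;> simp [h0] at ha
  have h1 : ∀ n, Run.stateAt M.init (ω.map Prod.fst Prod.fst) n =
      (Run.stateAt (M.prod N).init ω n).1 := fun n => by
    rw [Run.stateAt, Run.stateAt, ← last_map Prod.fst Prod.fst, ← Run.pre_map]; rfl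
  have h2 : ∀ n, Run.stateAt N.init (ω.map Prod.snd Prod.snd) n =
      (Run.stateAt (M.prod N).init ω n).2 := fun n => by
    rw [Run.stateAt, Run.stateAt, ← last_map Prod.snd Prod.snd, ← Run.pre_map]; rfl
  refine ⟨fun n => ?_, fun n => ?_⟩
  · rw [h1, h1]
    exact (key _ _ _ (h n).1 (h n).2).1
  · rw [h2, h2]
    exact (key _ _ _ (h n).1 (h n).2).2

theorem IsPossible.stateAt_succ_eq {ω : Run S A} (h : M.IsPossible ω) {T : Finset S}
    (hT : ∀ t ∈ T, M.IsAbsorbing t) {n : ℕ} (hn : Run.stateAt M.init ω n ∈ T) :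
    Run.stateAt M.init ω (n + 1) = Run.stateAt M.init ω n :=
  (hT _ hn).eq_of_pos (h n).1 (h n).2

theorem IsPossible.stateAt_eq_of_le {ω : Run S A} (h : M.IsPossible ω) {T : Finset S}
    (hT : ∀ t ∈ T, M.IsAbsorbing t) {m n : ℕ} (hmn : m ≤ n) (hm : Run.stateAt M.init ω m ∈ T) :
    Run.stateAt M.init ω n = Run.stateAt M.init ω m := by
  induction n, hmn using Nat.le_induction with
  | base => rfl
  | succ n _ ih => rw [h.stateAt_succ_eq hT (by rwa [ih]), ih]

end MDP

/-! ### State probabilities and the variance as a limit. -/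

namespace MDP

/-- Extension of a function on `T` by zero. -/
def extendZero {S : Type*} [DecidableEq S] {T : Finset S} (y : T → ℝ) (s : S) : ℝ :=
  if h : s ∈ T then y ⟨s, h⟩ else 0

theorem extendZero_coe {S : Type*} [DecidableEq S] {T : Finset S} (y : T → ℝ) (q : T) :
    extendZero y (q : S) = y q := by
  simp [extendZero]

theorem extendZero_of_notMem {S : Type*} [DecidableEq S] {T : Finset S} (y : T → ℝ) {s : S}
    (hs : s ∉ T) : extendZero y s = 0 :=
  dif_neg hs

theorem sum_extendZero_mul {S : Type*} [Fintype S] [DecidableEq S] {T : Finset S} (y : T → ℝ)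
    (f : S → ℝ) : ∑ s, extendZero y s * f s = ∑ q : T, y q * f q := by
  rw [← Finset.sum_subset (Finset.subset_univ T) fun s _ hs => by
    rw [extendZero_of_notMem y hs, zero_mul], ← Finset.sum_coe_sort]
  exact Finset.sum_congr rfl fun q _ => by rw [extendZero_coe]

theorem bilinearObjective_eq_sum {S : Type*} [Fintype S] [DecidableEq S] {T : Finset S}
    (wgt : T → ℚ) (y y' : T → ℝ) :
    bilinearObjective wgt y y' = 1 / 2 * ∑ s, ∑ u, extendZero y s * extendZero y' u *
      (extendZero (fun q => (wgt q : ℝ)) s - extendZero (fun q => (wgt q : ℝ)) u) ^ 2 := by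
  simp_rw [bilinearObjective, mul_assoc, ← Finset.mul_sum, sum_extendZero_mul, extendZero_coe]

variable {S A : Type*} [Fintype S] [Fintype A] {M : MDP S A} {T : Finset S}

open Classical in
theorem exists_WR_eq {wgt : T → ℚ} {ω : Run S A} (h : ∃ n, Run.stateAt M.init ω n ∈ T) :
    ∃ n, ∃ hn : Run.stateAt M.init ω n ∈ T,
      (∀ m < n, Run.stateAt M.init ω m ∉ T) ∧ M.WR T wgt ω = wgt ⟨_, hn⟩ :=
  ⟨Nat.find h, Nat.find_spec h, fun _ => Nat.find_min h, by rw [WR, dif_pos h]⟩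

theorem pairVariance_WR_of_init_mem (hM : M.init ∈ T) (wgt : T → ℚ) (σ τ : M.Scheduler) :
    M.pairVariance (M.WR T wgt) σ τ = 0 := by
  have h : ∀ ω, M.WR T wgt ω = wgt ⟨M.init, hM⟩ := fun ω => by
    obtain ⟨n, hn, hmin, he⟩ := exists_WR_eq (wgt := wgt) (ω := ω) ⟨0, hM⟩
    obtain rfl : n = 0 := Nat.eq_zero_of_not_pos fun hpos => hmin 0 hpos hM
    exact he
  simp [pairVariance, h]

variable [DecidableEq S]

/-- The sequence is constant from the first visit to `T` on; on a run that avoids `T` it is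
constantly zero, matching the default value of `WR`. -/
theorem IsPossible.tendsto_WR (hT : ∀ t ∈ T, M.IsAbsorbing t) (wgt : T → ℚ) {ω : Run S A}
    (hω : M.IsPossible ω) :
    Tendsto (fun n => extendZero (fun q => (wgt q : ℝ)) (Run.stateAt M.init ω n)) atTop
      (𝓝 (M.WR T wgt ω)) := by
  by_cases h : ∃ n, Run.stateAt M.init ω n ∈ T
  · obtain ⟨m, hm, -, he⟩ := exists_WR_eq (wgt := wgt) h
    rw [he, ← extendZero_coe (fun q => (wgt q : ℝ))]
    refine tendsto_const_nhds.congr' ?_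
    filter_upwards [eventually_ge_atTop m] with n hn
    rw [hω.stateAt_eq_of_le hT hn hm]
  · rw [WR, dif_neg h]
    refine tendsto_const_nhds.congr fun n => ?_
    rw [extendZero_of_notMem _ fun hn => h ⟨n, hn⟩]

namespace Scheduler

/-- The probability that the `n`-th state is `s`. -/
noncomputable def stateProb (σ : M.Scheduler) (n : ℕ) (s : S) : ℝ :=
  σ.expect n fun π => if π.last = s then 1 else 0

theorem expect_last (σ : M.Scheduler) (n : ℕ) (g : S → ℝ) :
    σ.expect n (fun π => g π.last) = ∑ s, σ.stateProb n s * g s := by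
  simp_rw [stateProb, ← expect_mul_const]
  rw [← expect_sum]
  simp

theorem stateProb_nonneg (σ : M.Scheduler) (n : ℕ) (s : S) : 0 ≤ σ.stateProb n s :=
  σ.expect_nonneg n fun π => by split_ifs <;> norm_num

theorem sum_stateProb (σ : M.Scheduler) (n : ℕ) : ∑ s, σ.stateProb n s = 1 := by
  simpa [σ.expect_const] using (σ.expect_last n fun _ => 1).symm

theorem expect_prod_last (σ τ : M.Scheduler) (n : ℕ) (G : S × S → ℝ) :
    (σ.prod τ).expect n (fun π => G π.last) =
      ∑ s, ∑ u, σ.stateProb n s * τ.stateProb n u * G (s, u) := by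
  simp_rw [stateProb, ← expect_prod, ← expect_mul_const]
  simp_rw [← expect_sum]
  congr 1
  funext π
  simp only [last_map]
  simp

theorem tendsto_sum_stateProb (hT : ∀ t ∈ T, M.IsAbsorbing t) (σ : M.Scheduler)
    (hσ : ∀ᵐ ω ∂σ.measure, ∃ n, Run.stateAt M.init ω n ∈ T) :
    Tendsto (fun n => ∑ s ∈ T, σ.stateProb n s) atTop (𝓝 1) := by
  let f : FinPath S A → ℝ := fun π => if π.last ∈ T then 1 else 0
  have hf : ∀ π, ‖f π‖ ≤ 1 := fun π => by simp only [f]; split_ifs <;> simp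
  have h1 : ∀ n, ∑ s ∈ T, σ.stateProb n s = ∫ ω, f (Run.pre M.init ω n) ∂σ.measure := fun n => by
    rw [integral_pre σ n f]
    refine Eq.symm ((σ.expect_last n fun s => if s ∈ T then (1 : ℝ) else 0).trans ?_)
    simp
  have h2 : ∫ _, (1 : ℝ) ∂σ.measure = 1 := by simp
  refine Tendsto.congr (fun n => (h1 n).symm) ?_
  refine Eq.subst (motive := fun c => Tendsto _ _ (𝓝 c)) h2 ?_
  refine tendsto_integral_of_dominated_convergence (fun _ => 1)
    (fun n => (Run.measurable_comp_pre M.init n f).aestronglyMeasurable) (integrable_const _)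
    (fun n => ae_of_all _ fun ω => hf _) ?_
  filter_upwards [hσ, σ.ae_isPossible] with ω ⟨m, hm⟩ hω
  refine tendsto_const_nhds.congr' ?_
  filter_upwards [eventually_ge_atTop m] with n hn
  refine (if_pos ?_).symm
  change Run.stateAt M.init ω n ∈ T
  rwa [hω.stateAt_eq_of_le hT hn hm]

theorem tendsto_stateProb_zero (hT : ∀ t ∈ T, M.IsAbsorbing t) (σ : M.Scheduler)
    (hσ : ∀ᵐ ω ∂σ.measure, ∃ n, Run.stateAt M.init ω n ∈ T) {s : S} (hs : s ∉ T) :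
    Tendsto (fun n => σ.stateProb n s) atTop (𝓝 0) := by
  have h := (tendsto_sum_stateProb hT σ hσ).const_sub 1
  rw [sub_self] at h
  refine squeeze_zero (fun n => σ.stateProb_nonneg n s) (fun n => ?_) h
  rw [← σ.sum_stateProb n, ← Finset.sum_sdiff (Finset.subset_univ T), add_sub_cancel_right]
  exact Finset.single_le_sum (fun u _ => σ.stateProb_nonneg n u) (by simp [hs])

end Scheduler

theorem integrable_and_tendsto_integral_WR (hT : ∀ t ∈ T, M.IsAbsorbing t) (wgt : T → ℚ)
    (σ τ : M.Scheduler) :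
    Integrable (fun ω : Run (S × S) (A × A) =>
        (M.WR T wgt (ω.map Prod.fst Prod.fst) - M.WR T wgt (ω.map Prod.snd Prod.snd)) ^ 2)
        (σ.prod τ).measure ∧
    Tendsto (fun n => ∑ s, ∑ u, σ.stateProb n s * τ.stateProb n u *
      (extendZero (fun q => (wgt q : ℝ)) s - extendZero (fun q => (wgt q : ℝ)) u) ^ 2) atTop
      (𝓝 (∫ ω, (M.WR T wgt (ω.map Prod.fst Prod.fst) - M.WR T wgt (ω.map Prod.snd Prod.snd)) ^ 2
        ∂(σ.prod τ).measure)) := by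
  let G : S × S → ℝ := fun p =>
    (extendZero (fun q => (wgt q : ℝ)) p.1 - extendZero (fun q => (wgt q : ℝ)) p.2) ^ 2
  let D : ℕ → Run (S × S) (A × A) → ℝ := fun n ω =>
    (fun π : FinPath (S × S) (A × A) => G π.last) (Run.pre (M.prod M).init ω n)
  have hlim : ∀ᵐ ω ∂(σ.prod τ).measure, Tendsto (fun n => D n ω) atTop (𝓝
      ((M.WR T wgt (ω.map Prod.fst Prod.fst) - M.WR T wgt (ω.map Prod.snd Prod.snd)) ^ 2)) := by
    filter_upwards [(σ.prod τ).ae_isPossible] with ω hω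
    refine (((hω.components.1.tendsto_WR hT wgt).sub (hω.components.2.tendsto_WR hT wgt)).pow
      2).congr fun n => ?_
    have h1 := Run.pre_map Prod.fst Prod.fst (M.prod M).init ω n
    have h2 := Run.pre_map Prod.snd Prod.snd (M.prod M).init ω n
    change Run.pre M.init _ n = _ at h1
    change Run.pre M.init _ n = _ at h2
    rw [Run.stateAt, Run.stateAt, h1, h2, last_map, last_map]
  have hD : ∀ n, Measurable (D n) := fun n =>
    Run.measurable_comp_pre (M.prod M).init n fun π => G π.last
  -- There are finitely many pairs of states, so the sum of all values of the nonnegative `G` is a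
  -- dominating constant.
  have hG : ∀ p, ‖G p‖ ≤ ∑ p, G p := fun p => by
    rw [Real.norm_of_nonneg (sq_nonneg _)]
    exact Finset.single_le_sum (f := G) (fun p _ => sq_nonneg _) (Finset.mem_univ p)
  constructor
  · refine Integrable.of_bound (aestronglyMeasurable_of_tendsto_ae atTop
      (fun n => (hD n).aestronglyMeasurable) hlim) (∑ p, G p) ?_
    filter_upwards [hlim] with ω hω
    exact le_of_tendsto hω.norm (Eventually.of_forall fun n => hG _)
  · have h := tendsto_integral_of_dominated_convergence (fun _ => ∑ p, G p)
      (fun n => (hD n).aestronglyMeasurable) (integrable_const _)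
      (fun n => ae_of_all _ fun ω => hG _) hlim
    refine h.congr fun n => ?_
    exact (Scheduler.integral_pre _ n fun π => G π.last).trans
      (Scheduler.expect_prod_last σ τ n G)

theorem pairVariance_WR_eq (hT : ∀ t ∈ T, M.IsAbsorbing t) (wgt : T → ℚ) {σ τ : M.Scheduler}
    {y y' : T → ℝ}
    (hσ : ∀ s, Tendsto (fun n => σ.stateProb n s) atTop (𝓝 (extendZero y s)))
    (hτ : ∀ s, Tendsto (fun n => τ.stateProb n s) atTop (𝓝 (extendZero y' s))) :
    M.pairVariance (M.WR T wgt) σ τ = bilinearObjective wgt y y' := by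
  rw [pairVariance, bilinearObjective_eq_sum]
  congr 1
  refine tendsto_nhds_unique (integrable_and_tendsto_integral_WR hT wgt σ τ).2 ?_
  exact tendsto_finsetSum _ fun s _ => tendsto_finsetSum _ fun u _ =>
    ((hσ s).mul (hτ u)).mul_const _

end MDP

/-! ### Flow equations and occupation measures of schedulers. -/

namespace MDP

variable {S A : Type*} [Fintype S] [Fintype A] {M : MDP S A} {T : Finset S}

theorem IsAbsorbing.P_eq_zero {s t : S} (h : M.IsAbsorbing s) {a : A} (ha : a ∈ M.enabled s)
    (hne : t ≠ s) : M.P s a t = 0 := by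
  by_contra h0
  exact hne (h.eq_of_pos ha ((M.P_nonneg s a t).lt_of_ne' h0))

theorem Scheduler.prob_le_one (σ : M.Scheduler) (π : FinPath S A) (a : A) : σ.prob π a ≤ 1 :=
  (Finset.single_le_sum (fun b _ => σ.prob_nonneg π b) (Finset.mem_univ a)).trans
    (σ.sum_prob π).le

variable [DecidableEq S]

/-- The total flow into `s` from states outside of `T`. -/
noncomputable def inflow (M : MDP S A) (T : Finset S) (x : S → A → ℝ) (s : S) : ℝ :=
  ∑ t ∈ Tᶜ, ∑ b ∈ M.enabled t, x t b * (M.P t b s : ℝ)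

/-- Absorbing states send nothing outside `T`, so the flow equations close on the complement of `T`.
-/
theorem sum_eq_inflow_of_notMem (hT : ∀ t ∈ T, M.IsAbsorbing t) (x : S → A → ℝ) {s : S}
    (hs : s ∉ T) : ∑ t, ∑ b ∈ M.enabled t, x t b * (M.P t b s : ℝ) = M.inflow T x s := by
  refine (Finset.sum_subset (Finset.subset_univ _) fun t _ ht => ?_).symm
  have ht' : t ∈ T := by simpa using ht
  refine Finset.sum_eq_zero fun b hb => ?_
  rw [(hT t ht').P_eq_zero hb fun h => hs (by rwa [h]), Rat.cast_zero, mul_zero]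

theorem sum_eq_inflow_of_mem (hT : ∀ t ∈ T, M.IsAbsorbing t) (x : S → A → ℝ) {q : S} (hq : q ∈ T) :
    ∑ t, ∑ b ∈ M.enabled t, x t b * (M.P t b q : ℝ) =
      ∑ b ∈ M.enabled q, x q b + M.inflow T x q := by
  rw [← Finset.sum_add_sum_compl T, inflow, add_left_inj, Finset.sum_eq_single_of_mem q hq]
  · exact Finset.sum_congr rfl fun b hb => by rw [hT q hq b hb, Rat.cast_one, mul_one]
  · intro t ht hne
    refine Finset.sum_eq_zero fun b hb => ?_
    rw [(hT t ht).P_eq_zero hb hne.symm, Rat.cast_zero, mul_zero]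

theorem inflow_mono {x x' : S → A → ℝ} (h : ∀ s ∉ T, ∀ a ∈ M.enabled s, x s a ≤ x' s a) (s : S) :
    M.inflow T x s ≤ M.inflow T x' s :=
  Finset.sum_le_sum fun t ht => Finset.sum_le_sum fun b hb =>
    mul_le_mul_of_nonneg_right (h t (by simpa using ht) b hb) (M.P_cast_nonneg _ _ _)

theorem sum_inflow (x : S → A → ℝ) :
    ∑ s, M.inflow T x s = ∑ t ∈ Tᶜ, ∑ b ∈ M.enabled t, x t b := by
  simp_rw [inflow]
  rw [Finset.sum_comm]
  refine Finset.sum_congr rfl fun t _ => ?_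
  rw [Finset.sum_comm]
  exact Finset.sum_congr rfl fun b hb => by
    rw [← Finset.mul_sum, sum_P_of_mem_enabled hb, mul_one]

theorem continuous_inflow (s : S) : Continuous fun x : S → A → ℝ => M.inflow T x s := by
  unfold inflow
  fun_prop

theorem OccupationConstraints.iff_inflow (hT : ∀ t ∈ T, M.IsAbsorbing t) {x : S → A → ℝ}
    {y : T → ℝ} : M.OccupationConstraints T x y ↔
      (∀ s, ∀ a ∈ M.enabled s, 0 ≤ x s a) ∧
      (∀ s ∉ T, ∑ a ∈ M.enabled s, x s a = M.inflow T x s + if s = M.init then 1 else 0) ∧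
      ∀ q : T, y q = M.inflow T x q := by
  constructor
  · rintro ⟨h1, h2, h3⟩
    exact ⟨h1, fun s hs => by rw [h2 s hs, sum_eq_inflow_of_notMem hT x hs], h3⟩
  · rintro ⟨h1, h2, h3⟩
    exact ⟨h1, fun s hs => by rw [h2 s hs, sum_eq_inflow_of_notMem hT x hs], h3⟩

/-- Conservation of mass: summing the flow equations over the complement of `T`, all internal flow
cancels and only the unit source is left. The source is absent when the initial state is in `T`. -/
theorem OccupationConstraints.sum_eq (hT : ∀ t ∈ T, M.IsAbsorbing t) {x : S → A → ℝ} {y : T → ℝ}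
    (h : M.OccupationConstraints T x y) : ∑ q, y q = if M.init ∈ T then 0 else 1 := by
  obtain ⟨-, h2, h3⟩ := (OccupationConstraints.iff_inflow hT).1 h
  have h4 := M.sum_inflow (T := T) x
  rw [← Finset.sum_add_sum_compl T,
    Finset.sum_congr rfl fun t ht => h2 t (by simpa using ht), Finset.sum_add_distrib,
    Finset.sum_ite_eq', add_comm, add_right_inj] at h4
  rw [Finset.sum_congr rfl fun q _ => h3 q, Finset.sum_coe_sort T (M.inflow T x), h4]
  by_cases hM : M.init ∈ T <;> simp [hM]

theorem OccupationConstraints.nonneg_reach {x : S → A → ℝ} {y : T → ℝ}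
    (h : M.OccupationConstraints T x y) (q : T) : 0 ≤ y q := by
  rw [h.reach]
  exact Finset.sum_nonneg fun t _ => Finset.sum_nonneg fun b hb =>
    mul_nonneg (h.nonneg t b hb) (M.P_cast_nonneg _ _ _)

namespace Scheduler

/-- The probability that the `n`-th state is `s` and that the next action is `a`. -/
noncomputable def actProb (σ : M.Scheduler) (n : ℕ) (s : S) (a : A) : ℝ :=
  σ.expect n fun π => if π.last = s then σ.prob π a else 0

variable (σ : M.Scheduler)

theorem actProb_nonneg (n : ℕ) (s : S) (a : A) : 0 ≤ σ.actProb n s a :=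
  σ.expect_nonneg n fun π => by split_ifs; exacts [σ.prob_nonneg _ _, le_rfl]

theorem actProb_le_stateProb (n : ℕ) (s : S) (a : A) : σ.actProb n s a ≤ σ.stateProb n s :=
  σ.expect_mono n fun π => by split_ifs; exacts [σ.prob_le_one _ _, le_rfl]

theorem sum_actProb (n : ℕ) (s : S) : ∑ a ∈ M.enabled s, σ.actProb n s a = σ.stateProb n s := by
  simp_rw [actProb, stateProb, ← expect_sum]
  congr 1
  funext π
  split_ifs with h
  · rw [← h, σ.sum_enabled_prob]
  · simp

theorem stateProb_zero (s : S) : σ.stateProb 0 s = if s = M.init then 1 else 0 := by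
  simp [stateProb, expect, FinPath.last, eq_comm]

theorem stateProb_succ (n : ℕ) (s : S) : σ.stateProb (n + 1) s =
    ∑ t, ∑ b ∈ M.enabled t, σ.actProb n t b * (M.P t b s : ℝ) := by
  simp_rw [actProb, ← expect_mul_const, ← expect_sum]
  rw [stateProb, expect]
  congr 1
  funext π
  rw [σ.next_last fun t => if t = s then 1 else 0]
  simp [ite_mul]

/-- The expected number of visits before time `N` to `s` with next action `a`. -/
noncomputable def occupation (σ : M.Scheduler) (N : ℕ) (s : S) (a : A) : ℝ :=
  ∑ n ∈ range N, σ.actProb n s a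

theorem occupation_nonneg (N : ℕ) (s : S) (a : A) : 0 ≤ σ.occupation N s a :=
  Finset.sum_nonneg fun n _ => σ.actProb_nonneg n s a

theorem occupation_monotone (s : S) (a : A) : Monotone fun N => σ.occupation N s a :=
  monotone_nat_of_le_succ fun N => by
    simp only [occupation, Finset.sum_range_succ]
    linarith [σ.actProb_nonneg N s a]

theorem sum_occupation (N : ℕ) (s : S) :
    ∑ a ∈ M.enabled s, σ.occupation N s a = ∑ n ∈ range N, σ.stateProb n s := by
  simp_rw [occupation, ← sum_actProb]
  exact Finset.sum_comm

theorem inflow_occupation (N : ℕ) (s : S) :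
    M.inflow T (σ.occupation N) s = ∑ n ∈ range N, M.inflow T (σ.actProb n) s := by
  simp_rw [inflow, occupation, Finset.sum_mul]
  rw [Finset.sum_comm (s := range N)]
  exact Finset.sum_congr rfl fun t _ => Finset.sum_comm

/-- A visit to `s` is either at time zero or an arrival from outside `T`; departures before `N` are
arrivals before `N + 1`. -/
theorem sum_occupation_succ (hT : ∀ t ∈ T, M.IsAbsorbing t) (N : ℕ) {s : S} (hs : s ∉ T) :
    ∑ a ∈ M.enabled s, σ.occupation (N + 1) s a =
      M.inflow T (σ.occupation N) s + if s = M.init then 1 else 0 := by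
  rw [sum_occupation, Finset.sum_range_succ', inflow_occupation, stateProb_zero]
  simp_rw [stateProb_succ, sum_eq_inflow_of_notMem hT _ hs]

theorem stateProb_eq_inflow (hT : ∀ t ∈ T, M.IsAbsorbing t) (N : ℕ) {q : S} (hq : q ∈ T) :
    σ.stateProb N q = M.inflow T (σ.occupation N) q + if q = M.init then 1 else 0 := by
  induction N with
  | zero => simp [stateProb_zero, inflow_occupation]
  | succ N ih =>
    rw [stateProb_succ, sum_eq_inflow_of_mem hT _ hq, sum_actProb, ih, inflow_occupation,
      inflow_occupation, Finset.sum_range_succ]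
    ring

theorem exists_occupationConstraints (hT : ∀ t ∈ T, M.IsAbsorbing t) (hM : M.init ∉ T)
    (hσ : ∀ᵐ ω ∂σ.measure, ∃ n, Run.stateAt M.init ω n ∈ T) {B : ℝ} (hB0 : 0 ≤ B)
    (hB : ∀ N, ∀ s ∉ T, ∀ a, σ.occupation N s a ≤ B) :
    ∃ (x : S → A → ℝ) (y : T → ℝ), M.OccupationConstraints T x y ∧
      (∀ s a, x s a ∈ Set.Icc 0 B) ∧
      ∀ s, Tendsto (fun n => σ.stateProb n s) atTop (𝓝 (extendZero y s)) := by
  -- Visit counts in `T` can diverge. They are replaced by zero, which is harmless because `inflow`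
  -- ignores them.
  let z : ℕ → S → A → ℝ := fun N s a => if s ∈ T then 0 else σ.occupation N s a
  have hz : ∀ N s a, z N s a ∈ Set.Icc 0 B := fun N s a => by
    simp only [z]
    split_ifs with h
    · exact ⟨le_rfl, hB0⟩
    · exact ⟨σ.occupation_nonneg N s a, hB N s h a⟩
  have hmono : ∀ s a, Monotone fun N => z N s a := fun s a => by
    simp only [z]
    split_ifs with h
    · exact monotone_const
    · exact σ.occupation_monotone s a
  have hconv : ∀ s a, ∃ l, Tendsto (fun N => z N s a) atTop (𝓝 l) := fun s a =>
    ⟨_, tendsto_atTop_ciSup (hmono s a) ⟨B, Set.forall_mem_range.2 fun N => (hz N s a).2⟩⟩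
  choose x hx using hconv
  have hlim : Tendsto z atTop (𝓝 x) :=
    tendsto_pi_nhds.2 fun s => tendsto_pi_nhds.2 fun a => hx s a
  have hxB : ∀ s a, x s a ∈ Set.Icc 0 B := fun s a =>
    isClosed_Icc.mem_of_tendsto (hx s a) (Eventually.of_forall fun N => hz N s a)
  have hin : ∀ N s, M.inflow T (σ.occupation N) s = M.inflow T (z N) s := fun N s =>
    Finset.sum_congr rfl fun t ht => Finset.sum_congr rfl fun b _ => by
      simp only [z, if_neg (Finset.mem_compl.1 ht)]
  have hinl : ∀ s, Tendsto (fun N => M.inflow T (z N) s) atTop (𝓝 (M.inflow T x s)) := fun s =>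
    ((continuous_inflow s).tendsto x).comp hlim
  refine ⟨x, fun q => M.inflow T x q, (OccupationConstraints.iff_inflow hT).2
    ⟨fun s a _ => (hxB s a).1, fun s hs => ?_, fun q => rfl⟩, hxB, fun s => ?_⟩
  · have h1 : Tendsto (fun N => ∑ a ∈ M.enabled s, z (N + 1) s a) atTop
        (𝓝 (∑ a ∈ M.enabled s, x s a)) :=
      tendsto_finsetSum _ fun a _ => (hx s a).comp (tendsto_add_atTop_nat 1)
    refine tendsto_nhds_unique h1 (((hinl s).add_const _).congr fun N => ?_)
    rw [← hin, ← σ.sum_occupation_succ hT N hs]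
    exact Finset.sum_congr rfl fun a _ => by simp only [z, if_neg hs]
  · by_cases hs : s ∈ T
    · rw [extendZero, dif_pos hs]
      refine (hinl s).congr fun N => ?_
      rw [σ.stateProb_eq_inflow hT N hs, if_neg fun h : s = M.init => hM (h ▸ hs), add_zero, hin]
    · rw [extendZero_of_notMem _ hs]
      exact σ.tendsto_stateProb_zero hT hσ hs

end Scheduler

end MDP

/-! ### From solutions of the constraints to memoryless schedulers. -/

namespace MDP

variable {S A : Type*} [Fintype S] [Fintype A] {M : MDP S A} {T : Finset S}

theorem enabled_nonempty (M : MDP S A) (s : S) : (M.enabled s).Nonempty :=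
  let ⟨a, ha⟩ := M.exists_enabled s
  ⟨a, mem_enabled.2 ha⟩

/-- The scheduler that chooses `a` in state `s` with probability `p s a`. -/
def Scheduler.memoryless (p : S → A → ℝ) (h0 : ∀ s a, 0 ≤ p s a) (h1 : ∀ s, ∑ a, p s a = 1)
    (h2 : ∀ s, ∀ a ∉ M.enabled s, p s a = 0) : M.Scheduler where
  prob π a := p π.last a
  prob_nonneg π a := h0 π.last a
  sum_prob π := h1 π.last
  prob_eq_zero π a h := h2 π.last a h

open Classical in
/-- The scheduler that chooses `d s` in state `s`. -/
noncomputable def Scheduler.deterministic (d : S → A) (hd : ∀ s, d s ∈ M.enabled s) : M.Scheduler :=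
  Scheduler.memoryless (fun s a => if a = d s then 1 else 0)
    (fun s a => by split_ifs <;> norm_num) (fun s => by simp)
    fun s a ha => if_neg fun h : a = d s => ha (h ▸ hd s)

instance (M : MDP S A) : Nonempty M.Scheduler :=
  ⟨Scheduler.deterministic (fun s => (M.enabled_nonempty s).choose)
    fun s => (M.enabled_nonempty s).choose_spec⟩

variable [DecidableEq S]

theorem actProb_memoryless (p : S → A → ℝ) (h0 : ∀ s a, 0 ≤ p s a) (h1 : ∀ s, ∑ a, p s a = 1)
    (h2 : ∀ s, ∀ a ∉ M.enabled s, p s a = 0) (n : ℕ) (s : S) (a : A) :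
    (Scheduler.memoryless p h0 h1 h2).actProb n s a =
      (Scheduler.memoryless p h0 h1 h2).stateProb n s * p s a := by
  rw [Scheduler.actProb, Scheduler.stateProb, ← Scheduler.expect_mul_const]
  congr 1
  funext π
  split_ifs with h
  · rw [← h, one_mul]; rfl
  · rw [zero_mul]

theorem OccupationConstraints.exists_scheduler (hT : ∀ t ∈ T, M.IsAbsorbing t) (hM : M.init ∉ T)
    (hreach : ∀ σ : M.Scheduler, ∀ᵐ ω ∂σ.measure, ∃ n, Run.stateAt M.init ω n ∈ T)
    {x : S → A → ℝ} {y : T → ℝ} (h : M.OccupationConstraints T x y) :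
    ∃ σ : M.Scheduler,
      ∀ s, Tendsto (fun n => σ.stateProb n s) atTop (𝓝 (extendZero y s)) := by
  classical
  let X : S → ℝ := fun s => ∑ a ∈ M.enabled s, x s a
  have hX0 : ∀ s, 0 ≤ X s := fun s => Finset.sum_nonneg (h.nonneg s)
  -- Normalized `x`, with the uniform choice at states that carry no mass.
  let p : S → A → ℝ := fun s a =>
    if a ∈ M.enabled s then (if X s = 0 then ((M.enabled s).card : ℝ)⁻¹ else x s a / X s) else 0
  have h0 : ∀ s a, 0 ≤ p s a := fun s a => by
    simp only [p]
    split_ifs with ha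
    exacts [by positivity, div_nonneg (h.nonneg s a ha) (hX0 s), le_rfl]
  have h1 : ∀ s, ∑ a, p s a = 1 := fun s => by
    simp only [p, Finset.sum_ite_mem, Finset.univ_inter]
    by_cases hs : X s = 0
    · have : ((M.enabled s).card : ℝ) ≠ 0 := by
        exact_mod_cast (Finset.card_pos.2 (M.enabled_nonempty s)).ne'
      simp [hs, this]
    · simp only [if_neg hs, ← Finset.sum_div]
      exact div_self hs
  have h2 : ∀ s, ∀ a ∉ M.enabled s, p s a = 0 := fun s a ha => if_neg ha
  have hp : ∀ s, ∀ a ∈ M.enabled s, ∀ c, 0 ≤ c → c ≤ X s → c * p s a ≤ x s a := by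
    intro s a ha c hc hcX
    simp only [p, if_pos ha]
    split_ifs with hs
    · rw [le_antisymm (hs ▸ hcX) hc, zero_mul]
      exact h.nonneg s a ha
    · have hpos : 0 < X s := (hX0 s).lt_of_ne' hs
      rw [mul_div_assoc', div_le_iff₀ hpos, mul_comm]
      exact mul_le_mul_of_nonneg_left hcX (h.nonneg s a ha)
  let σ : M.Scheduler := Scheduler.memoryless p h0 h1 h2
  obtain ⟨-, hflow, hy⟩ := (OccupationConstraints.iff_inflow hT).1 h
  have hocc : ∀ N s a, σ.occupation N s a = (∑ n ∈ range N, σ.stateProb n s) * p s a :=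
    fun N s a => by
      rw [Finset.sum_mul]
      exact Finset.sum_congr rfl fun n _ => actProb_memoryless p h0 h1 h2 n s a
  -- Induction on time: a bound on earlier visits bounds the inflow, hence the visits to `s` by `X
  -- s`, and `hp` distributes this bound over the actions.
  have hle : ∀ N, ∀ s ∉ T, ∀ a ∈ M.enabled s, σ.occupation N s a ≤ x s a := by
    intro N
    induction N with
    | zero =>
      intro s _ a ha
      simpa [Scheduler.occupation] using h.nonneg s a ha
    | succ N ih =>
      intro s hs a ha
      rw [hocc]
      refine hp s a ha _ (Finset.sum_nonneg fun n _ => σ.stateProb_nonneg n s) ?_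
      rw [← σ.sum_occupation, σ.sum_occupation_succ hT N hs]
      simp only [X]
      rw [hflow s hs]
      exact add_le_add_left (inflow_mono ih s) _
  have hyle : ∀ N (q : T), σ.stateProb N q ≤ y q := fun N q => by
    rw [σ.stateProb_eq_inflow hT N q.2, if_neg fun hq : (q : S) = M.init => hM (hq ▸ q.2),
      add_zero, hy]
    exact inflow_mono (hle N) q
  refine ⟨σ, fun s => ?_⟩
  by_cases hs : s ∈ T
  · rw [extendZero, dif_pos hs]
    have hlim := (σ.tendsto_sum_stateProb hT (hreach σ)).const_sub 1
    rw [sub_self] at hlim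
    -- Every gap `y q - σ.stateProb n q` is nonnegative and their sum tends to zero, so each gap
    -- does.
    have hd : Tendsto (fun n => y ⟨s, hs⟩ - σ.stateProb n s) atTop (𝓝 0) := by
      refine squeeze_zero (fun n => sub_nonneg.2 (hyle n ⟨s, hs⟩)) (fun n => ?_) hlim
      have hsum := h.sum_eq hT
      rw [if_neg hM] at hsum
      rw [← hsum, ← Finset.sum_coe_sort T, ← Finset.sum_sub_distrib]
      exact Finset.single_le_sum (f := fun q : T => y q - σ.stateProb n q)
        (fun q _ => sub_nonneg.2 (hyle n q)) (Finset.mem_univ (⟨s, hs⟩ : T))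
    simpa using hd.const_sub (y ⟨s, hs⟩)
  · rw [extendZero_of_notMem _ hs]
    exact σ.tendsto_stateProb_zero hT (hreach σ) hs

/-! ### Avoidance probabilities and the uniform bound on visits. -/

/-- The maximal probability to avoid `T` for `n` steps. -/
noncomputable def avoidProb (M : MDP S A) (T : Finset S) : ℕ → S → ℝ
  | 0, s => if s ∈ T then 0 else 1
  | n + 1, s => if s ∈ T then 0 else
      (M.enabled s).sup' (M.enabled_nonempty s) fun a => ∑ t, (M.P s a t : ℝ) * avoidProb M T n t

theorem avoidProb_of_mem (n : ℕ) {s : S} (hs : s ∈ T) : M.avoidProb T n s = 0 := by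
  cases n <;> exact if_pos hs

theorem sum_mul_avoidProb_le (n : ℕ) {s : S} (hs : s ∉ T) {a : A} (ha : a ∈ M.enabled s) :
    ∑ t, (M.P s a t : ℝ) * M.avoidProb T n t ≤ M.avoidProb T (n + 1) s := by
  rw [avoidProb, if_neg hs]
  exact Finset.le_sup' (fun a => ∑ t, (M.P s a t : ℝ) * M.avoidProb T n t) ha

theorem avoidProb_nonneg (n : ℕ) (s : S) : 0 ≤ M.avoidProb T n s := by
  induction n generalizing s with
  | zero => rw [avoidProb]; split_ifs <;> norm_num
  | succ n ih =>
    by_cases hs : s ∈ T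
    · exact (avoidProb_of_mem _ hs).ge
    · obtain ⟨a, ha⟩ := M.enabled_nonempty s
      exact (Finset.sum_nonneg fun t _ => mul_nonneg (M.P_cast_nonneg s a t) (ih t)).trans
        (sum_mul_avoidProb_le n hs ha)

theorem avoidProb_succ_le (n : ℕ) (s : S) : M.avoidProb T (n + 1) s ≤ M.avoidProb T n s := by
  induction n generalizing s with
  | zero =>
    rw [avoidProb]
    by_cases hs : s ∈ T
    · rw [if_pos hs, avoidProb_of_mem _ hs]
    · rw [if_neg hs, avoidProb, if_neg hs]
      refine Finset.sup'_le _ _ fun a ha => ?_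
      rw [← sum_P_of_mem_enabled ha]
      refine Finset.sum_le_sum fun t _ => mul_le_of_le_one_right (M.P_cast_nonneg _ _ _) ?_
      rw [avoidProb]
      split_ifs <;> norm_num
  | succ n ih =>
    by_cases hs : s ∈ T
    · rw [avoidProb_of_mem _ hs, avoidProb_of_mem _ hs]
    · rw [avoidProb, if_neg hs]
      refine Finset.sup'_le _ _ fun a ha => ?_
      exact (Finset.sum_le_sum fun t _ => mul_le_mul_of_nonneg_left (ih t)
        (M.P_cast_nonneg _ _ _)).trans (sum_mul_avoidProb_le n hs ha)

theorem exists_tendsto_avoidProb (M : MDP S A) (T : Finset S) :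
    ∃ u : S → ℝ, ∀ s, Tendsto (fun n => M.avoidProb T n s) atTop (𝓝 (u s)) :=
  ⟨_, fun s => tendsto_atTop_ciInf (antitone_nat_of_succ_le fun n => avoidProb_succ_le n s)
    ⟨0, Set.forall_mem_range.2 fun n => avoidProb_nonneg n s⟩⟩

theorem sup_eq_of_tendsto_avoidProb {u : S → ℝ}
    (hu : ∀ s, Tendsto (fun n => M.avoidProb T n s) atTop (𝓝 (u s))) {s : S} (hs : s ∉ T) :
    u s = (M.enabled s).sup' (M.enabled_nonempty s) fun a => ∑ t, (M.P s a t : ℝ) * u t := by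
  refine tendsto_nhds_unique ((hu s).comp (tendsto_add_atTop_nat 1)) ?_
  have h : Tendsto (fun n => (M.enabled s).sup' (M.enabled_nonempty s) fun a =>
      ∑ t, (M.P s a t : ℝ) * M.avoidProb T n t) atTop (𝓝 ((M.enabled s).sup'
        (M.enabled_nonempty s) fun a => ∑ t, (M.P s a t : ℝ) * u t)) :=
    Tendsto.finset_sup'_nhds_apply _ fun a _ =>
      tendsto_finsetSum _ fun t _ => (hu t).const_mul _
  refine h.congr fun n => ?_
  rw [Function.comp_apply, avoidProb, if_neg hs]

/-- If every scheduler reaches `T` almost surely, then the maximal probabilities to avoid `T` for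
`n` steps from the initial state tend to zero. -/
theorem limit_avoidProb_init_eq_zero (hT : ∀ t ∈ T, M.IsAbsorbing t)
    (hreach : ∀ σ : M.Scheduler, ∀ᵐ ω ∂σ.measure, ∃ n, Run.stateAt M.init ω n ∈ T) {u : S → ℝ}
    (hu : ∀ s, Tendsto (fun n => M.avoidProb T n s) atTop (𝓝 (u s))) : u M.init = 0 := by
  classical
  have hu0 : ∀ s, 0 ≤ u s := fun s => ge_of_tendsto' (hu s) fun n => avoidProb_nonneg n s
  have huT : ∀ s ∈ T, u s = 0 := fun s hs =>
    tendsto_nhds_unique (hu s) (by simp [avoidProb_of_mem _ hs])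
  have hu1 : ∀ s, u s ≤ if s ∈ T then 0 else 1 := fun s =>
    (antitone_nat_of_succ_le fun n => avoidProb_succ_le n s).le_of_tendsto (hu s) 0
  -- The Bellman equation for `u` provides a maximizing action in each state; choosing it always
  -- makes `u` of the current state a martingale.
  have hmax : ∀ s, ∃ a ∈ M.enabled s, ∑ t, (M.P s a t : ℝ) * u t = u s := by
    intro s
    by_cases hs : s ∈ T
    · obtain ⟨a, ha⟩ := M.enabled_nonempty s
      refine ⟨a, ha, ?_⟩
      rw [Finset.sum_eq_single s (fun t _ hne => by
        rw [(hT s hs).P_eq_zero ha hne, Rat.cast_zero, zero_mul]) (by simp), huT s hs, mul_zero]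
    · obtain ⟨a, ha, he⟩ := Finset.exists_mem_eq_sup' (M.enabled_nonempty s)
        fun a => ∑ t, (M.P s a t : ℝ) * u t
      exact ⟨a, ha, by rw [sup_eq_of_tendsto_avoidProb hu hs, he]⟩
  choose d hd hdu using hmax
  let σ : M.Scheduler := Scheduler.deterministic d hd
  have hinv : ∀ n, σ.expect n (fun π => u π.last) = u M.init := by
    intro n
    induction n with
    | zero => rfl
    | succ n ih =>
      rw [← ih, Scheduler.expect]
      congr 1
      funext π
      rw [σ.next_last u, Finset.sum_eq_single_of_mem (d π.last) (hd _), hdu]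
      · simp [σ, Scheduler.deterministic, Scheduler.memoryless]
      · intro a _ hne
        simp [σ, Scheduler.deterministic, Scheduler.memoryless, hne]
  have hlim := (σ.tendsto_sum_stateProb hT (hreach σ)).const_sub 1
  rw [sub_self] at hlim
  -- Since `u` is zero on `T` and at most one elsewhere, its constant expectation is at most the
  -- probability of being outside `T` at time `n`, which tends to zero.
  refine le_antisymm (ge_of_tendsto' hlim fun n => ?_) (hu0 _)
  rw [← hinv n, σ.expect_last n u, ← σ.sum_stateProb n, ← Finset.sum_sdiff (Finset.subset_univ T),
    ← Finset.sum_sdiff (Finset.subset_univ T) (f := σ.stateProb n), add_sub_cancel_right]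
  rw [Finset.sum_eq_zero (s := T) fun s hs => by rw [huT s hs, mul_zero], add_zero]
  refine Finset.sum_le_sum fun s hs => mul_le_of_le_one_right (σ.stateProb_nonneg n s) ?_
  have := hu1 s
  rwa [if_neg (Finset.mem_sdiff.1 hs).2] at this

/-- The expected number of visits outside of `T` is bounded uniformly in the scheduler. -/
theorem exists_occupation_le (hT : ∀ t ∈ T, M.IsAbsorbing t)
    (hreach : ∀ σ : M.Scheduler, ∀ᵐ ω ∂σ.measure, ∃ n, Run.stateAt M.init ω n ∈ T) :
    ∃ B : ℝ, 0 ≤ B ∧ ∀ (σ : M.Scheduler) (N : ℕ), ∀ s ∉ T, ∀ a, σ.occupation N s a ≤ B := by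
  obtain ⟨u, hu⟩ := M.exists_tendsto_avoidProb T
  have hu0 : ∀ s, 0 ≤ u s := fun s => ge_of_tendsto' (hu s) fun n => avoidProb_nonneg n s
  -- At a zero of `u` outside `T`, the Bellman equation forces `u` to vanish at every possible
  -- successor.
  have hR : M.IsInvariant {s | u s = 0} := by
    refine ⟨limit_avoidProb_init_eq_zero hT hreach hu, fun s hs a ha t ht => ?_⟩
    by_cases hsT : s ∈ T
    · rwa [(hT s hsT).eq_of_pos ha ht]
    · have h1 : ∑ t, (M.P s a t : ℝ) * u t ≤ 0 := by
        rw [← show u s = 0 from hs, sup_eq_of_tendsto_avoidProb hu hsT]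
        exact Finset.le_sup' (fun a => ∑ t, (M.P s a t : ℝ) * u t) ha
      have h2 : (M.P s a t : ℝ) * u t ≤ 0 := (Finset.single_le_sum
        (f := fun t => (M.P s a t : ℝ) * u t)
        (fun t _ => mul_nonneg (M.P_cast_nonneg s a t) (hu0 t)) (Finset.mem_univ t)).trans h1
      have h3 : (0 : ℝ) < M.P s a t := by exact_mod_cast ht
      exact le_antisymm (nonpos_of_mul_nonpos_right h2 h3) (hu0 t)
  obtain ⟨K, hK⟩ : ∃ K, ∀ s, u s = 0 → M.avoidProb T K s ≤ 1 / 2 := by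
    refine (eventually_all.2 fun s => ?_ : ∀ᶠ K in atTop, ∀ s, _).exists
    by_cases hs : u s = 0
    · have h := hu s
      rw [hs] at h
      filter_upwards [h.eventually (ge_mem_nhds (by norm_num : (0 : ℝ) < 1 / 2))] with K hK _
      exact hK
    · exact Eventually.of_forall fun K h => absurd h hs
  -- A Lyapunov function: one step turns horizon `k` into at most horizon `k + 1`, so outside `T`
  -- the sum drops by at least `avoidProb` at horizon `0` minus that at `K`, that is, by at least `1
  -- - 1 / 2`.
  let g : S → ℝ := fun s => ∑ k ∈ range K, M.avoidProb T k s
  have hg0 : ∀ s, 0 ≤ g s := fun s => Finset.sum_nonneg fun k _ => avoidProb_nonneg k s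
  have hgT : ∀ s ∈ T, g s = 0 := fun s hs => Finset.sum_eq_zero fun k _ => avoidProb_of_mem k hs
  have hdrift : ∀ s, u s = 0 → ∀ a ∈ M.enabled s,
      ∑ t, (M.P s a t : ℝ) * g t ≤ g s - 1 / 2 * if s ∈ T then 0 else 1 := by
    intro s hs a ha
    by_cases hsT : s ∈ T
    · rw [if_pos hsT, Finset.sum_eq_single s (fun t _ hne => by
        rw [(hT s hsT).P_eq_zero ha hne, Rat.cast_zero, zero_mul]) (by simp), hgT s hsT]
      simp
    · have h1 : ∑ t, (M.P s a t : ℝ) * g t ≤ ∑ k ∈ range K, M.avoidProb T (k + 1) s := by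
        simp only [g, Finset.mul_sum]
        rw [Finset.sum_comm]
        exact Finset.sum_le_sum fun k _ => sum_mul_avoidProb_le k hsT ha
      have h2 : ∑ k ∈ range K, M.avoidProb T (k + 1) s + M.avoidProb T 0 s =
          g s + M.avoidProb T K s := by
        rw [← Finset.sum_range_succ' fun k => M.avoidProb T k s, Finset.sum_range_succ]
      have h3 : M.avoidProb T 0 s = 1 := if_neg hsT
      rw [if_neg hsT]
      linarith [hK s hs]
  -- Each visit outside `T` costs at least `1 / 2` of the initial budget `g M.init`, whence the
  -- factor `2`.
  refine ⟨2 * g M.init, mul_nonneg (by norm_num) (hg0 _), fun σ N s hs a => ?_⟩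
  let c : ℕ → ℝ := fun n => σ.expect n fun π => if π.last ∈ T then 0 else 1
  have hstep : ∀ n, σ.expect (n + 1) (fun π => g π.last) + 1 / 2 * c n ≤
      σ.expect n fun π => g π.last := by
    intro n
    rw [Scheduler.expect, ← Scheduler.expect_const_mul, ← Scheduler.expect_add]
    refine σ.expect_mono_of_isInvariant hR n fun π hπ => ?_
    have h1 : σ.next (fun π => g π.last) π ≤ ∑ b ∈ M.enabled π.last,
        σ.prob π b * (g π.last - 1 / 2 * if π.last ∈ T then 0 else 1) := by
      rw [σ.next_last g]
      exact Finset.sum_le_sum fun b hb =>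
        mul_le_mul_of_nonneg_left (hdrift _ hπ b hb) (σ.prob_nonneg _ _)
    rw [← Finset.sum_mul, σ.sum_enabled_prob, one_mul] at h1
    linarith
  have htel : 1 / 2 * ∑ n ∈ range N, c n + σ.expect N (fun π => g π.last) ≤ g M.init := by
    induction N with
    | zero => simp [Scheduler.expect, FinPath.last]
    | succ N ih =>
      rw [Finset.sum_range_succ]
      linarith [hstep N]
  have hc : σ.occupation N s a ≤ ∑ n ∈ range N, c n :=
    Finset.sum_le_sum fun n _ => (σ.actProb_le_stateProb n s a).trans
      (σ.expect_mono n fun π => by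
        by_cases h : π.last = s
        · rw [if_pos h, h, if_neg hs]
        · rw [if_neg h]; split_ifs <;> norm_num)
  linarith [σ.expect_nonneg N (f := fun π => g π.last) fun π => hg0 _]

end MDP

/-! ### Compactness and the maximum. -/

namespace MDP

variable {S A : Type*} [Fintype S] [Fintype A] {M : MDP S A} {T : Finset S}

variable [DecidableEq S]

/-- The nonnegative solutions `x` of the flow equations with entries at most `B`. -/
def boundedOccupations (M : MDP S A) (T : Finset S) (B : ℝ) : Set (S → A → ℝ) :=
  {x | (∀ s a, x s a ∈ Set.Icc 0 B) ∧
    ∀ s ∉ T, ∑ a ∈ M.enabled s, x s a = M.inflow T x s + if s = M.init then 1 else 0}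

/-- The cutoff `B` is needed: the constraints leave `x` on `T` unbounded above, and they allow
circulation in parts not reachable from the initial state. -/
theorem isCompact_boundedOccupations (M : MDP S A) (T : Finset S) (B : ℝ) :
    IsCompact (M.boundedOccupations T B) := by
  have h1 : IsCompact {x : S → A → ℝ | ∀ s, x s ∈ {z : A → ℝ | ∀ a, z a ∈ Set.Icc 0 B}} :=
    isCompact_pi_infinite fun _ => isCompact_pi_infinite fun _ => isCompact_Icc
  have h2 : IsClosed {x : S → A → ℝ | ∀ s ∉ T,
      ∑ a ∈ M.enabled s, x s a = M.inflow T x s + if s = M.init then 1 else 0} := by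
    simp only [Set.ofPred_forall]
    refine isClosed_iInter fun s => isClosed_iInter fun _ => isClosed_eq (by fun_prop) ?_
    exact (continuous_inflow s).add continuous_const
  exact h1.inter_right h2

theorem boundedOccupations.occupationConstraints (hT : ∀ t ∈ T, M.IsAbsorbing t) {B : ℝ}
    {x : S → A → ℝ} (hx : x ∈ M.boundedOccupations T B) :
    M.OccupationConstraints T x fun q => M.inflow T x q :=
  (OccupationConstraints.iff_inflow hT).2 ⟨fun s a _ => (hx.1 s a).1, hx.2, fun _ => rfl⟩

theorem continuous_bilinearObjective_inflow (wgt : T → ℚ) :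
    Continuous fun p : (S → A → ℝ) × (S → A → ℝ) =>
      bilinearObjective wgt (fun q => M.inflow T p.1 q) fun q => M.inflow T p.2 q := by
  have h1 : ∀ s, Continuous fun p : (S → A → ℝ) × (S → A → ℝ) => M.inflow T p.1 s := fun s =>
    (continuous_inflow s).comp continuous_fst
  have h2 : ∀ s, Continuous fun p : (S → A → ℝ) × (S → A → ℝ) => M.inflow T p.2 s := fun s =>
    (continuous_inflow s).comp continuous_snd
  unfold bilinearObjective
  fun_prop

/-- `WR` is constant, and the linear system has no source, so every feasible `y` is zero. -/
theorem isGreatest_demonicVariance_of_init_mem (hT : ∀ t ∈ T, M.IsAbsorbing t) (wgt : T → ℚ)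
    (hM : M.init ∈ T) : BddAbove (Set.range fun p : M.Scheduler × M.Scheduler =>
      M.pairVariance (M.WR T wgt) p.1 p.2) ∧
    IsGreatest
      {v : ℝ | ∃ (x : S → A → ℝ) (y : T → ℝ) (x' : S → A → ℝ) (y' : T → ℝ),
        M.OccupationConstraints T x y ∧ M.OccupationConstraints T x' y' ∧
        v = MDP.bilinearObjective wgt y y'}
      (M.demonicVariance (M.WR T wgt)) := by
  have hV : M.demonicVariance (M.WR T wgt) = 0 := by
    simp [demonicVariance, pairVariance_WR_of_init_mem hM]
  have h0 : M.OccupationConstraints T 0 0 := by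
    refine (OccupationConstraints.iff_inflow hT).2 ⟨by simp, fun s hs => ?_, by simp [inflow]⟩
    rw [if_neg fun h : s = M.init => hs (h ▸ hM)]
    simp [inflow]
  refine ⟨⟨0, Set.forall_mem_range.2 fun p => (pairVariance_WR_of_init_mem hM wgt _ _).le⟩, ?_⟩
  rw [hV]
  refine ⟨⟨0, 0, 0, 0, h0, h0, by simp [bilinearObjective]⟩, ?_⟩
  rintro v ⟨x, y, x', y', h, -, rfl⟩
  have hsum := h.sum_eq hT
  rw [if_pos hM, Finset.sum_eq_zero_iff_of_nonneg fun q _ => h.nonneg_reach q] at hsum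
  simp [bilinearObjective, fun q => hsum q (Finset.mem_univ q)]

theorem isGreatest_demonicVariance_of_init_notMem (hT : ∀ t ∈ T, M.IsAbsorbing t) (wgt : T → ℚ)
    (hreach : ∀ σ : M.Scheduler, ∀ᵐ ω ∂σ.measure, ∃ n, Run.stateAt M.init ω n ∈ T)
    (hM : M.init ∉ T) : BddAbove (Set.range fun p : M.Scheduler × M.Scheduler =>
      M.pairVariance (M.WR T wgt) p.1 p.2) ∧
    IsGreatest
      {v : ℝ | ∃ (x : S → A → ℝ) (y : T → ℝ) (x' : S → A → ℝ) (y' : T → ℝ),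
        M.OccupationConstraints T x y ∧ M.OccupationConstraints T x' y' ∧
        v = MDP.bilinearObjective wgt y y'}
      (M.demonicVariance (M.WR T wgt)) := by
  obtain ⟨B, hB0, hB⟩ := exists_occupation_le hT hreach
  let Y : (S → A → ℝ) → T → ℝ := fun x q => M.inflow T x q
  have hσ : ∀ σ : M.Scheduler, ∃ x ∈ M.boundedOccupations T B,
      ∀ s, Tendsto (fun n => σ.stateProb n s) atTop (𝓝 (extendZero (Y x) s)) := fun σ => by
    obtain ⟨x, y, hxy, hxB, hlim⟩ := σ.exists_occupationConstraints hT hM (hreach σ) hB0 (hB σ)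
    obtain ⟨-, h2, h3⟩ := (OccupationConstraints.iff_inflow hT).1 hxy
    obtain rfl : y = Y x := funext h3
    exact ⟨x, ⟨hxB, h2⟩, hlim⟩
  obtain ⟨σ₀⟩ := (inferInstance : Nonempty M.Scheduler)
  obtain ⟨x₀, hx₀, -⟩ := hσ σ₀
  have hKc := M.isCompact_boundedOccupations T B
  obtain ⟨⟨x, x'⟩, ⟨hx, hx'⟩, hmax⟩ := (hKc.prod hKc).exists_isMaxOn ⟨(x₀, x₀), hx₀, hx₀⟩
    (continuous_bilinearObjective_inflow wgt).continuousOn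
  have hle : ∀ p : M.Scheduler × M.Scheduler, M.pairVariance (M.WR T wgt) p.1 p.2 ≤
      bilinearObjective wgt (Y x) (Y x') := fun p => by
    obtain ⟨z, hz, hzl⟩ := hσ p.1
    obtain ⟨z', hz', hzl'⟩ := hσ p.2
    rw [pairVariance_WR_eq hT wgt hzl hzl']
    exact isMaxOn_iff.1 hmax (z, z') ⟨hz, hz'⟩
  have hbdd : BddAbove (Set.range fun p : M.Scheduler × M.Scheduler =>
      M.pairVariance (M.WR T wgt) p.1 p.2) := ⟨_, Set.forall_mem_range.2 hle⟩
  -- This covers all feasible pairs, not only those bounded by `B`, because `exists_scheduler` needs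
  -- no bound.
  have hge : ∀ {x y x' y'}, M.OccupationConstraints T x y → M.OccupationConstraints T x' y' →
      bilinearObjective wgt y y' ≤ M.demonicVariance (M.WR T wgt) := by
    intro x y x' y' h h'
    obtain ⟨σ, hσ⟩ := h.exists_scheduler hT hM hreach
    obtain ⟨τ, hτ⟩ := h'.exists_scheduler hT hM hreach
    rw [← pairVariance_WR_eq hT wgt hσ hτ]
    exact le_ciSup hbdd (σ, τ)
  have hx := boundedOccupations.occupationConstraints hT hx
  have hx' := boundedOccupations.occupationConstraints hT hx'
  refine ⟨hbdd, ⟨x, Y x, x', Y x', hx, hx', le_antisymm (ciSup_le hle) (hge hx hx')⟩, ?_⟩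
  rintro v ⟨z, y, z', y', h, h', rfl⟩
  exact hge h h'

end MDP

theorem mainTheorem8 {S A : Type*} [Fintype S] [Fintype A] [DecidableEq S]
    (M : MDP S A) (T : Finset S) (hT : ∀ t ∈ T, M.IsAbsorbing t) (wgt : T → ℚ)
    (hreach : ∀ σ : M.Scheduler, ∀ᵐ ω ∂σ.measure, ∃ n, Run.stateAt M.init ω n ∈ T) :
    (∀ σ τ : M.Scheduler,
      Integrable (fun ω : Run (S × S) (A × A) =>
        (M.WR T wgt (ω.map Prod.fst Prod.fst) - M.WR T wgt (ω.map Prod.snd Prod.snd)) ^ 2)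
        (σ.prod τ).measure) ∧
    BddAbove (Set.range fun p : M.Scheduler × M.Scheduler =>
      M.pairVariance (M.WR T wgt) p.1 p.2) ∧
    IsGreatest
      {v : ℝ | ∃ (x : S → A → ℝ) (y : T → ℝ) (x' : S → A → ℝ) (y' : T → ℝ),
        M.OccupationConstraints T x y ∧ M.OccupationConstraints T x' y' ∧
        v = MDP.bilinearObjective wgt y y'}
      (M.demonicVariance (M.WR T wgt)) := by
  refine ⟨fun σ τ => (MDP.integrable_and_tendsto_integral_WR hT wgt σ τ).1, ?_⟩
  by_cases hM : M.init ∈ T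
  · exact MDP.isGreatest_demonicVariance_of_init_mem hT wgt hM
  · exact MDP.isGreatest_demonicVariance_of_init_notMem hT wgt hreach hM
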